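/- Let $F$ be a field and let $P$ be a finite-dimensional Poisson algebra over $F$: a vector space with a commutative associative (not necessarily unital) bilinear product $\cdot$ and a Lie bracket $[\,,]$ satisfying $[x\cdot y,z]=[x,z]\cdot y+x\cdot[y,z]$. Subalgebras and ideals of $P$ are linear subspaces that are closed (respectively, absorbing) for both products. Write $P_L$ for the Lie algebra $(P,[\,,])$, and $A\cdot B$ and $[A,B]$ for the linear spans of the products and of the brackets of elements of $A$ with elements of $B$; put $A^2=A\cdot A+[A,A]$ and $P_A^2=P\cdot P$. $P$ is solvable if the series $P^{(0)}=P$, $P^{(n+1)}=P^{(n)}\cdot P^{(n)}+[P^{(n)},P^{(n)}]$ reaches $0$. The nilradical $N$ of $P$ is the largest ideal of $P$ that is nilpotent for each of the two products. The Frattini ideal $\phi(P)$ is the largest ideal of $P$ contained in the intersection of all maximal (proper) subalgebras of $P$, and $\phi_L(P)$ is the largest Lie ideal of $P_L$ contained in the intersection of all maximal (proper) Lie subalgebras of $P_L$ (an empty intersection being $P$). $P$ is $\phi$-free if $\phi(P)=0$, and $P_L$ is $\phi_L$-free if $\phi_L(P)=0$. 1. If $P$ is solvable, then $P$ is $\phi$-free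 if and only if there is a subalgebra $U$ with $P=N\dotplus U$ (direct sum of vector spaces), $P_A^2=0$, and $P_L$ is a $\phi_L$-free solvable Lie algebra. 2. If $P$ is solvable and $\phi$-free and $F$ has characteristic zero, then $U^2=0$ for every subalgebra $U$ with $P=N\dotplus U$. 3. Here $P_L$ may be any $\phi_L$-free solvable Lie algebra: whenever $P_A^2=0$ and $P_L$ is solvable and $\phi_L$-free, $P$ is solvable and $\phi$-free. -/

import Mathlib

/-- A commutative associative (not necessarily unital) ring which is also a Lie ring on the same
additive group, the two products being related by the Leibniz rule. -/
class PoissonRing (P : Type*) extends NonUnitalCommRing P, LieRing P where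
  leibniz_mul : ∀ x y z : P, ⁅x * y, z⁆ = ⁅x, z⁆ * y + x * ⁅y, z⁆

/-- A Poisson algebra over a field: both products are bilinear. -/
class PoissonAlgebra (F : Type*) (P : Type*) [Field F] [PoissonRing P]
    extends LieAlgebra F P where
  smul_mul : ∀ (a : F) (x y : P), (a • x) * y = a • (x * y)

namespace PoissonAlgebra

section Basic

variable (F : Type*) {P : Type*} [Field F] [PoissonRing P] [PoissonAlgebra F P]

/-- `A · B`, the linear span of all associative products `x * y` with `x ∈ A`, `y ∈ B`. -/
def mulSpan (A B : Submodule F P) : Submodule F P :=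
  Submodule.span F {z | ∃ x ∈ A, ∃ y ∈ B, x * y = z}

/-- `[A, B]`, the linear span of all brackets `⁅x, y⁆` with `x ∈ A`, `y ∈ B`. -/
def lieSpan (A B : Submodule F P) : Submodule F P :=
  Submodule.span F {z | ∃ x ∈ A, ∃ y ∈ B, ⁅x, y⁆ = z}

/-- A subalgebra: a linear subspace closed under both products. -/
def IsSubalgebra (S : Submodule F P) : Prop :=
  ∀ x ∈ S, ∀ y ∈ S, x * y ∈ S ∧ ⁅x, y⁆ ∈ S

/-- A (Poisson) ideal; since `*` is commutative and the bracket is anticommutative, left and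
right ideals agree. -/
def IsIdeal (I : Submodule F P) : Prop :=
  ∀ x ∈ I, ∀ y : P, x * y ∈ I ∧ ⁅x, y⁆ ∈ I

/-- A maximal subalgebra: maximal among the proper subalgebras. -/
def IsMaximalSubalgebra (M : Submodule F P) : Prop :=
  IsSubalgebra F M ∧ M ≠ ⊤ ∧ ∀ S : Submodule F P, IsSubalgebra F S → M < S → S = ⊤

/-- `I_A^(n+1)`, where `I_A^1 = I` and `I_A^(n+1) = I_A^n · I`. -/
def assocPow (I : Submodule F P) : ℕ → Submodule F P
  | 0 => I
  | n + 1 => mulSpan F (assocPow I n) I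

/-- `I_L^(n+1)`, where `I_L^1 = I` and `I_L^(n+1) = [I_L^n, I]`. -/
def liePow (I : Submodule F P) : ℕ → Submodule F P
  | 0 => I
  | n + 1 => lieSpan F (liePow I n) I

end Basic

section Algebra

variable (F : Type*) (P : Type*) [Field F] [PoissonRing P] [PoissonAlgebra F P]

/-- The derived sequence `P^(0) = P`, `P^(n+1) = P^(n) · P^(n) + [P^(n), P^(n)]`. -/
def derivedSeq : ℕ → Submodule F P
  | 0 => ⊤
  | n + 1 => mulSpan F (derivedSeq n) (derivedSeq n) ⊔ lieSpan F (derivedSeq n) (derivedSeq n)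

/-- Solvability of a Poisson algebra (with respect to both products together). -/
def IsSolvable : Prop := ∃ m : ℕ, derivedSeq F P m = ⊥

/-- The nilradical `N(P)`: the sum of all ideals that are both associative nilpotent and Lie
nilpotent. In finite dimension it is the largest such ideal. -/
def nilradical : Submodule F P :=
  sSup {I | IsIdeal F I ∧ (∃ m, assocPow F I m = ⊥) ∧ ∃ m, liePow F I m = ⊥}

/-- The Frattini subalgebra: the intersection of all maximal subalgebras (the whole algebra
if there are none). -/
def frattiniSubalgebra : Submodule F P := sInf {M | IsMaximalSubalgebra F M}

/-- The Frattini ideal `φ(P)`: the largest ideal contained in the Frattini subalgebra. -/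
def frattiniIdeal : Submodule F P := sSup {I | IsIdeal F I ∧ I ≤ frattiniSubalgebra F P}

/-- `P` is `φ`-free if its Frattini ideal is zero. -/
def IsPhiFree : Prop := frattiniIdeal F P = ⊥

theorem frattiniIdeal_le : frattiniIdeal F P ≤ frattiniSubalgebra F P :=
  sSup_le fun _ hI => hI.2

theorem isIdeal_frattiniIdeal : IsIdeal F (frattiniIdeal F P) := by
  intro x hx y
  unfold frattiniIdeal at hx ⊢
  rw [sSup_eq_iSup'] at hx
  induction hx using Submodule.iSup_induction' with
  | mem I x hx =>
    exact ⟨(le_sSup I.2) (I.2.1 x hx y).1, (le_sSup I.2) (I.2.1 x hx y).2⟩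
  | zero => simp
  | add a b _ _ ha hb =>
    rw [add_mul, add_lie]
    exact ⟨add_mem ha.1 hb.1, add_mem ha.2 hb.2⟩

end Algebra

section Lie

variable (F : Type*) (L : Type*) [Field F] [LieRing L] [LieAlgebra F L]

/-- The Frattini subalgebra of a Lie algebra: the intersection of its maximal (proper) Lie
subalgebras. -/
def lieFrattiniSubalgebra : LieSubalgebra F L := sInf {M | IsCoatom M}

/-- `φ_L`: the largest Lie ideal contained in the Lie Frattini subalgebra. -/
def lieFrattiniIdeal : LieIdeal F L :=
  sSup {I | I.toLieSubalgebra ≤ lieFrattiniSubalgebra F L}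

/-- A Lie algebra is `φ_L`-free if its Lie Frattini ideal is zero. -/
def IsPhiLFree : Prop := lieFrattiniIdeal F L = ⊥

theorem lieFrattiniIdeal_le :
    (lieFrattiniIdeal F L).toLieSubalgebra ≤ lieFrattiniSubalgebra F L := by
  change (lieFrattiniIdeal F L).toSubmodule ≤ (lieFrattiniSubalgebra F L).toSubmodule
  rw [lieFrattiniIdeal, LieSubmodule.sSup_toSubmodule]
  refine sSup_le ?_
  rintro _ ⟨I, hI, rfl⟩
  exact hI

end Lie

end PoissonAlgebra

/-! Everything reduces to Lie theory once `P · P = 0`, since then subalgebras, ideals, Frattini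
ideals and derived series are the same for `P` and `P_L`. A solvable `φ`-free `P` satisfies this:
solvability makes `P` associatively nilpotent, and a maximal subalgebra `M` not containing `P · P`
would give `P = M + P · P`, hence `P = M + P^k` for every `k`, forcing `M = P`. So `P · P` is an
ideal inside the Frattini subalgebra (`mulSpan_top_le_frattiniSubalgebra`).

The same argument with brackets puts `[I, I]` in the Frattini subalgebra for a Lie nilpotent ideal
`I`. Hence the nilradical `N` of a `φ`-free algebra with zero product is abelian, and a minimal
supplement to it is a complement (`IsPhiFree.exists_isCompl`). In characteristic zero Lie's theorem
gives `[P, P] ≤ N`, so `[U, U] ≤ N ⊓ U = 0`. -/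

namespace LieModule

/-! ### Lie's theorem and nilpotent action of the derived algebra -/

open LieAlgebra TensorProduct Function

/-- Over a field of characteristic zero over which `V` is triangularizable, the derived algebra of
a solvable Lie algebra acts on `V` by nilpotent endomorphisms. -/
theorem isNilpotent_toEnd_of_mem_derivedSeries_of_isAlgClosed {k L : Type*} [Field k] [CharZero k]
    [IsAlgClosed k] [LieRing L] [LieAlgebra k L] [LieAlgebra.IsSolvable L] {x : L}
    (hx : x ∈ derivedSeries k L 1) (n : ℕ) (V : Type*) [AddCommGroup V] [Module k V]
    [LieRingModule L V] [LieModule k L V] [Module.Finite k V]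
    (hn : Module.finrank k V ≤ n) : _root_.IsNilpotent (toEnd k L V x) := by
  induction n generalizing V with
  | zero =>
    have : Subsingleton V := Module.finrank_zero_iff.mp (Nat.le_zero.mp hn)
    exact ⟨1, LinearMap.ext fun _ => Subsingleton.elim _ _⟩
  | succ n ih =>
    rcases subsingleton_or_nontrivial V with hV | hV
    · exact ⟨1, LinearMap.ext fun _ => Subsingleton.elim _ _⟩
    -- Lie's theorem: a common eigenspace `W ≠ 0`. Commutators act on it by zero, since scalars
    -- commute, and induction applies to `V ⧸ W`.
    obtain ⟨χ, hχ⟩ := exists_nontrivial_weightSpace_of_isSolvable k L V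
    set W : LieSubmodule k L V := weightSpace V χ
    have hker : ∀ w ∈ W, ⁅x, w⁆ = 0 := by
      intro w hw
      clear ih
      have hw' := (mem_weightSpace χ w).mp hw
      rw [← LieSubmodule.mem_toSubmodule, ← LieIdeal.toLieSubalgebra_toSubmodule,
        coe_derivedSeries_one_eq] at hx
      induction hx using Submodule.span_induction with
      | mem y hy =>
        obtain ⟨a, b, rfl⟩ := hy
        rw [lie_lie, hw', hw', lie_smul, lie_smul, hw', hw', smul_comm, sub_self]
      | zero => exact zero_lie _
      | add y z _ _ hy hz => rw [add_lie, hy, hz, add_zero]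
      | smul c y _ hy => rw [smul_lie, hy, smul_zero]
    have hlt : Module.finrank k (V ⧸ W) ≤ n := by
      have h1 : Module.finrank k (V ⧸ W.toSubmodule) + Module.finrank k W.toSubmodule
        = Module.finrank k V := Submodule.finrank_quotient_add_finrank W.toSubmodule
      have h2 : 0 < Module.finrank k W.toSubmodule := Module.finrank_pos (M := W)
      change Module.finrank k (V ⧸ W.toSubmodule) ≤ n
      omega
    have : Module.Finite k (V ⧸ W) := inferInstanceAs (Module.Finite k (V ⧸ W.toSubmodule))
    obtain ⟨m, hm⟩ := ih (V ⧸ W) hlt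
    have hmk : ∀ (j : ℕ) (v : V), LieSubmodule.Quotient.mk' W ((toEnd k L V x ^ j) v) =
        (toEnd k L (V ⧸ W) x ^ j) (LieSubmodule.Quotient.mk' W v) := by
      intro j v
      induction j with
      | zero => rfl
      | succ j hj =>
        rw [pow_succ', pow_succ', Module.End.mul_apply, Module.End.mul_apply, ← hj, toEnd_apply_apply,
          toEnd_apply_apply, LieModuleHom.map_lie]
    -- The `m`-th power sends `V` into `W`; one further application of `x` kills `W`.
    refine ⟨m + 1, LinearMap.ext fun v => ?_⟩
    rw [pow_succ', Module.End.mul_apply, toEnd_apply_apply]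
    refine hker _ ?_
    rw [← LieSubmodule.Quotient.mk_eq_zero, hmk, hm]
    rfl

/-- The derived algebra of a solvable Lie algebra in characteristic zero acts on any
finite-dimensional module by nilpotent endomorphisms. -/
theorem isNilpotent_toEnd_of_mem_derivedSeries {k L : Type*} [Field k] [CharZero k]
    [LieRing L] [LieAlgebra k L] [LieAlgebra.IsSolvable L] {x : L}
    (hx : x ∈ derivedSeries k L 1) (V : Type*) [AddCommGroup V] [Module k V]
    [LieRingModule L V] [LieModule k L V] [Module.Finite k V] :
    _root_.IsNilpotent (toEnd k L V x) := by
  -- Derived series commute with base change, and nilpotency descends because base change is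
  -- injective on endomorphisms.
  let A := AlgebraicClosure k
  have hx' : 1 ⊗ₜ[k] x ∈ derivedSeries A (A ⊗[k] L) 1 := by
    rw [derivedSeries_baseChange]
    exact Submodule.tmul_mem_baseChange_of_mem 1 hx
  have hinj : Injective (Module.End.baseChangeHom k A V) :=
    LinearMap.baseChangeHom_injective k V A
  rw [← IsNilpotent.map_iff hinj]
  change _root_.IsNilpotent ((toEnd k L V x).baseChange A)
  rw [← toEnd_baseChange]
  exact isNilpotent_toEnd_of_mem_derivedSeries_of_isAlgClosed hx' _ _ le_rfl

/-- In characteristic zero the derived algebra of a solvable Lie algebra acts nilpotently on any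
finite-dimensional module. -/
theorem isNilpotent_derivedSeries_one {k L : Type*} [Field k] [CharZero k]
    [LieRing L] [LieAlgebra k L] [LieAlgebra.IsSolvable L] (V : Type*) [AddCommGroup V] [Module k V]
    [LieRingModule L V] [LieModule k L V] [Module.Finite k V] :
    LieModule.IsNilpotent (derivedSeries k L 1) V := by
  -- Engel's theorem.
  rw [isNilpotent_iff_forall' (R := k)]
  exact fun x => isNilpotent_toEnd_of_mem_derivedSeries x.2 V

end LieModule

namespace PoissonAlgebra

/-! ### Powers, supplements, and `P · P` inside the Frattini subalgebra -/

section Basic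

variable {F : Type*} {P : Type*} [Field F] [PoissonRing P] [PoissonAlgebra F P]

theorem mul_smul' (a : F) (x y : P) : x * (a • y) = a • (x * y) := by
  rw [mul_comm, smul_mul, mul_comm]

theorem mul_mem_mulSpan {A B : Submodule F P} {x y : P} (hx : x ∈ A) (hy : y ∈ B) :
    x * y ∈ mulSpan F A B :=
  Submodule.subset_span ⟨x, hx, y, hy, rfl⟩

theorem lie_mem_lieSpan {A B : Submodule F P} {x y : P} (hx : x ∈ A) (hy : y ∈ B) :
    ⁅x, y⁆ ∈ lieSpan F A B :=
  Submodule.subset_span ⟨x, hx, y, hy, rfl⟩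

theorem mulSpan_le {A B C : Submodule F P} :
    mulSpan F A B ≤ C ↔ ∀ x ∈ A, ∀ y ∈ B, x * y ∈ C := by
  refine ⟨fun h x hx y hy => h (mul_mem_mulSpan hx hy), fun h => Submodule.span_le.mpr ?_⟩
  rintro _ ⟨x, hx, y, hy, rfl⟩
  exact h x hx y hy

theorem lieSpan_le {A B C : Submodule F P} :
    lieSpan F A B ≤ C ↔ ∀ x ∈ A, ∀ y ∈ B, ⁅x, y⁆ ∈ C := by
  refine ⟨fun h x hx y hy => h (lie_mem_lieSpan hx hy), fun h => Submodule.span_le.mpr ?_⟩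
  rintro _ ⟨x, hx, y, hy, rfl⟩
  exact h x hx y hy

theorem mulSpan_mono {A B C D : Submodule F P} (h : A ≤ C) (h' : B ≤ D) :
    mulSpan F A B ≤ mulSpan F C D :=
  mulSpan_le.mpr fun _ hx _ hy => mul_mem_mulSpan (h hx) (h' hy)

/-- Left multiplication maps a span of products into `D` as soon as it does so on generators. -/
theorem mul_mem_of_mem_mulSpan {A B D : Submodule F P} {x z : P} (hz : z ∈ mulSpan F A B)
    (h : ∀ p ∈ A, ∀ q ∈ B, x * (p * q) ∈ D) : x * z ∈ D := by
  induction hz using Submodule.span_induction with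
  | mem _ hw => obtain ⟨p, hp, q, hq, rfl⟩ := hw; exact h p hp q hq
  | zero => simp
  | add a b _ _ ha hb => rw [mul_add]; exact add_mem ha hb
  | smul c a _ ha => rw [mul_smul']; exact D.smul_mem c ha

/-- Left bracketing maps a span of brackets into `D` as soon as it does so on generators. -/
theorem lie_mem_of_mem_lieSpan {A B D : Submodule F P} {x z : P} (hz : z ∈ lieSpan F A B)
    (h : ∀ p ∈ A, ∀ q ∈ B, ⁅x, ⁅p, q⁆⁆ ∈ D) : ⁅x, z⁆ ∈ D := by
  induction hz using Submodule.span_induction with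
  | mem _ hw => obtain ⟨p, hp, q, hq, rfl⟩ := hw; exact h p hp q hq
  | zero => simp
  | add a b _ _ ha hb => rw [lie_add]; exact add_mem ha hb
  | smul c a _ ha => rw [lie_smul]; exact D.smul_mem c ha

theorem lie_mem_comm {D : Submodule F P} {x y : P} : ⁅x, y⁆ ∈ D ↔ ⁅y, x⁆ ∈ D := by
  rw [← lie_skew, neg_mem_iff]

theorem IsIdeal.sup {I J : Submodule F P} (hI : IsIdeal F I) (hJ : IsIdeal F J) :
    IsIdeal F (I ⊔ J) := by
  intro x hx y
  obtain ⟨i, hi, j, hj, rfl⟩ := Submodule.mem_sup.mp hx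
  rw [add_mul, add_lie]
  exact ⟨Submodule.add_mem_sup (hI i hi y).1 (hJ j hj y).1,
    Submodule.add_mem_sup (hI i hi y).2 (hJ j hj y).2⟩

theorem IsIdeal.sSup {S : Set (Submodule F P)} (hS : ∀ I ∈ S, IsIdeal F I) :
    IsIdeal F (sSup S) := by
  intro x hx y
  rw [sSup_eq_iSup'] at hx
  induction hx using Submodule.iSup_induction' with
  | mem I x hx =>
    exact ⟨(le_sSup I.2) (hS I I.2 x hx y).1, (le_sSup I.2) (hS I I.2 x hx y).2⟩
  | zero => simp
  | add a b _ _ ha hb =>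
    rw [add_mul, add_lie]
    exact ⟨add_mem ha.1 hb.1, add_mem ha.2 hb.2⟩

theorem IsSubalgebra.inf {S T : Submodule F P} (hS : IsSubalgebra F S) (hT : IsSubalgebra F T) :
    IsSubalgebra F (S ⊓ T) := fun x hx y hy =>
  ⟨⟨(hS x hx.1 y hy.1).1, (hT x hx.2 y hy.2).1⟩, ⟨(hS x hx.1 y hy.1).2, (hT x hx.2 y hy.2).2⟩⟩

theorem IsSubalgebra.sup_isIdeal {S I : Submodule F P} (hS : IsSubalgebra F S)
    (hI : IsIdeal F I) : IsSubalgebra F (S ⊔ I) := by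
  intro x hx y hy
  obtain ⟨s, hs, i, hi, rfl⟩ := Submodule.mem_sup.mp hx
  obtain ⟨t, ht, j, hj, rfl⟩ := Submodule.mem_sup.mp hy
  have h1 : s * j ∈ I := by rw [mul_comm]; exact (hI j hj s).1
  have h2 : ⁅s, j⁆ ∈ I := lie_mem_comm.mpr (hI j hj s).2
  rw [add_mul, mul_add s, add_assoc, add_lie, lie_add s, add_assoc]
  exact ⟨Submodule.add_mem_sup (hS s hs t ht).1 (add_mem h1 (hI i hi _).1),
    Submodule.add_mem_sup (hS s hs t ht).2 (add_mem h2 (hI i hi _).2)⟩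

/-- Starting point of every Frattini argument below: an ideal outside a maximal subalgebra
supplements it. -/
theorem IsMaximalSubalgebra.sup_eq_top {M I : Submodule F P} (hM : IsMaximalSubalgebra F M)
    (hI : IsIdeal F I) (h : ¬ I ≤ M) : M ⊔ I = ⊤ :=
  hM.2.2 _ (hM.1.sup_isIdeal hI) (left_lt_sup.mpr h)

/-- The only place where the Leibniz rule linking the two products is needed. -/
theorem isIdeal_mulSpan_top : IsIdeal F (mulSpan F (⊤ : Submodule F P) ⊤) := by
  intro x hx y
  refine ⟨mul_mem_mulSpan trivial trivial, lie_mem_comm.mpr ?_⟩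
  induction hx using Submodule.span_induction with
  | mem _ hw =>
    obtain ⟨p, -, q, -, rfl⟩ := hw
    rw [lie_mem_comm, PoissonRing.leibniz_mul]
    exact add_mem (mul_mem_mulSpan trivial trivial) (mul_mem_mulSpan trivial trivial)
  | zero => simp
  | add a b _ _ ha hb => rw [lie_add]; exact add_mem ha hb
  | smul c a _ ha => rw [lie_smul]; exact Submodule.smul_mem _ c ha

/-- Associativity allows regrouping; index `n` means `n + 1` factors, so `a + b + 1` splits into `a`
and `b`. -/
theorem assocPow_add_succ_le (I : Submodule F P) (a b : ℕ) :
    assocPow F I (a + b + 1) ≤ mulSpan F (assocPow F I a) (assocPow F I b) := by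
  induction b with
  | zero => exact le_rfl
  | succ b ih =>
    refine mulSpan_le.mpr fun w hw z hz => ?_
    rw [mul_comm]
    refine mul_mem_of_mem_mulSpan (ih hw) fun p hp q hq => ?_
    rw [mul_comm, mul_assoc]
    exact mul_mem_mulSpan hp (mul_mem_mulSpan hq hz)

/-- A product of `2 ^ m` factors can be bracketed as a balanced binary tree of depth `m`; thus
solvability implies associative nilpotency. -/
theorem assocPow_le_derivedSeq (m : ℕ) :
    assocPow F (⊤ : Submodule F P) (2 ^ m - 1) ≤ derivedSeq F P m := by
  induction m with
  | zero => exact le_rfl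
  | succ m ih =>
    have h : 2 ^ (m + 1) - 1 = (2 ^ m - 1) + (2 ^ m - 1) + 1 := by
      have := Nat.one_le_two_pow (n := m)
      omega
    rw [h]
    exact (assocPow_add_succ_le _ _ _).trans ((mulSpan_mono ih ih).trans le_sup_left)

/-- Writing factors modulo `P · P` as elements of `M`, each correction term has at least one more
factor. Iteration gives `P = M + P^k` for all `k`. -/
theorem assocPow_le_sup {M : Submodule F P} (hM : IsSubalgebra F M)
    (h : M ⊔ mulSpan F ⊤ ⊤ = ⊤) (k : ℕ) :
    assocPow F ⊤ k ≤ M ⊔ assocPow F ⊤ (k + 1) := by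
  induction k with
  | zero => exact le_top.trans h.ge
  | succ k ih =>
    refine mulSpan_le.mpr fun x hx z _ => ?_
    obtain ⟨m', hm', t', ht', rfl⟩ := Submodule.mem_sup.mp (h.ge (trivial : z ∈ ⊤))
    have h1 : x * t' ∈ assocPow F ⊤ (k + 2) :=
      mul_mem_of_mem_mulSpan ht' fun p _ q _ => by
        rw [← mul_assoc]
        exact mul_mem_mulSpan (mul_mem_mulSpan hx trivial) trivial
    obtain ⟨m, hm, t, ht, rfl⟩ := Submodule.mem_sup.mp (ih hx)
    rw [mul_add, add_mul m t m', add_assoc (m * m')]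
    exact Submodule.add_mem_sup (hM m hm m' hm').1 (add_mem (mul_mem_mulSpan ht trivial) h1)

theorem liePow_le_sup {M I : Submodule F P} (hM : IsSubalgebra F M) (hI : IsIdeal F I)
    (h : M ⊔ lieSpan F I I = ⊤) (k : ℕ) :
    liePow F I k ≤ M ⊔ liePow F I (k + 1) := by
  have hle : lieSpan F I I ≤ I := lieSpan_le.mpr fun x hx y _ => (hI x hx y).2
  induction k with
  | zero => exact le_top.trans h.ge
  | succ k ih =>
    refine lieSpan_le.mpr fun x hx z hz => ?_
    obtain ⟨m', hm', t', ht', rfl⟩ := Submodule.mem_sup.mp (h.ge (trivial : z ∈ ⊤))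
    -- Needed so that `⁅t, m'⁆` lies in the next Lie power of `I`. For `⁅x, t'⁆` the Jacobi identity
    -- replaces associativity.
    have hm'I : m' ∈ I := (Submodule.add_mem_iff_left I (hle ht')).mp hz
    have h1 : ⁅x, t'⁆ ∈ liePow F I (k + 2) :=
      lie_mem_of_mem_lieSpan ht' fun p hp q hq => by
        rw [leibniz_lie]
        exact add_mem (lie_mem_lieSpan (lie_mem_lieSpan hx hp) hq)
          (lie_mem_comm.mpr (lie_mem_lieSpan (lie_mem_lieSpan hx hq) hp))
    obtain ⟨m, hm, t, ht, rfl⟩ := Submodule.mem_sup.mp (ih hx)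
    rw [lie_add, add_lie m t m', add_assoc ⁅m, m'⁆]
    exact Submodule.add_mem_sup (hM m hm m' hm').2 (add_mem (lie_mem_lieSpan ht hm'I) h1)

theorem IsPhiFree.eq_bot (h : IsPhiFree F P) {I : Submodule F P} (hI : IsIdeal F I)
    (hle : I ≤ frattiniSubalgebra F P) : I = ⊥ :=
  eq_bot_iff.mpr ((le_sSup ⟨hI, hle⟩ : I ≤ frattiniIdeal F P).trans h.le)

/-- In a solvable Poisson algebra, `P · P` lies in the Frattini subalgebra. -/
theorem mulSpan_top_le_frattiniSubalgebra (hs : IsSolvable F P) :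
    mulSpan F (⊤ : Submodule F P) ⊤ ≤ frattiniSubalgebra F P := by
  refine le_sInf fun M hM => ?_
  by_contra hn
  have htop := hM.sup_eq_top isIdeal_mulSpan_top hn
  obtain ⟨m, hm⟩ := hs
  have hall : ∀ k, (⊤ : Submodule F P) ≤ M ⊔ assocPow F ⊤ k := by
    intro k
    induction k with
    | zero => exact le_sup_right
    | succ k ih => exact ih.trans (sup_le le_sup_left (assocPow_le_sup hM.1 htop k))
  have hbot := eq_bot_iff.mpr ((assocPow_le_derivedSeq (F := F) (P := P) m).trans hm.le)
  refine hM.2.1 (eq_top_iff.mpr ?_)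
  simpa [hbot] using hall (2 ^ m - 1)

theorem IsPhiFree.mulSpan_top_eq_bot (h : IsPhiFree F P) (hs : IsSolvable F P) :
    mulSpan F (⊤ : Submodule F P) ⊤ = ⊥ :=
  h.eq_bot isIdeal_mulSpan_top (mulSpan_top_le_frattiniSubalgebra hs)

theorem mul_eq_zero_of_mulSpan_top (h : mulSpan F (⊤ : Submodule F P) ⊤ = ⊥) (x y : P) :
    x * y = 0 :=
  (Submodule.mem_bot F).mp (h.le (mul_mem_mulSpan trivial trivial))

end Basic

/-! ### Zero associative product: Poisson notions coincide with Lie notions -/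

section ZeroMul

variable {F : Type*} {P : Type*} [Field F] [PoissonRing P] [PoissonAlgebra F P]

theorem isSubalgebra_iff (h0 : ∀ x y : P, x * y = 0) {S : Submodule F P} :
    IsSubalgebra F S ↔ ∀ x ∈ S, ∀ y ∈ S, ⁅x, y⁆ ∈ S := by
  simp [IsSubalgebra, h0]

theorem isIdeal_iff (h0 : ∀ x y : P, x * y = 0) {I : Submodule F P} :
    IsIdeal F I ↔ ∀ x ∈ I, ∀ y : P, ⁅x, y⁆ ∈ I := by
  simp [IsIdeal, h0]

theorem isMaximalSubalgebra_iff_isCoatom (h0 : ∀ x y : P, x * y = 0) (M : LieSubalgebra F P) :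
    IsMaximalSubalgebra F M.toSubmodule ↔ IsCoatom M := by
  constructor
  · rintro ⟨-, h1, h2⟩
    refine ⟨fun h => h1 (by rw [h]; rfl), fun S hS => ?_⟩
    have := h2 S.toSubmodule ((isSubalgebra_iff h0).mpr fun x hx y hy => S.lie_mem hx hy) hS
    exact LieSubalgebra.toSubmodule_injective this
  · rintro ⟨h1, h2⟩
    refine ⟨(isSubalgebra_iff h0).mpr fun x hx y hy => M.lie_mem hx hy,
      fun h => h1 (LieSubalgebra.toSubmodule_injective h), fun S hS hlt => ?_⟩
    let S' : LieSubalgebra F P := { S with lie_mem' := fun {x y} hx hy => (hS x hx y hy).2 }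
    have : S' = ⊤ := h2 S' hlt
    exact congrArg LieSubalgebra.toSubmodule this

theorem frattiniSubalgebra_eq (h0 : ∀ x y : P, x * y = 0) :
    frattiniSubalgebra F P = (lieFrattiniSubalgebra F P).toSubmodule := by
  rw [frattiniSubalgebra, lieFrattiniSubalgebra, LieSubalgebra.sInf_toSubmodule]
  congr 1
  ext M
  constructor
  · intro hM
    let M' : LieSubalgebra F P := { M with lie_mem' := fun {x y} hx hy => (hM.1 x hx y hy).2 }
    exact ⟨M', (isMaximalSubalgebra_iff_isCoatom h0 M').mp hM, rfl⟩
  · rintro ⟨M', hM', rfl⟩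
    exact (isMaximalSubalgebra_iff_isCoatom h0 M').mpr hM'

theorem isPhiFree_iff_isPhiLFree (h0 : ∀ x y : P, x * y = 0) :
    IsPhiFree F P ↔ IsPhiLFree F P := by
  rw [IsPhiFree, IsPhiLFree, frattiniIdeal, lieFrattiniIdeal, sSup_eq_bot, sSup_eq_bot,
    frattiniSubalgebra_eq h0]
  constructor
  · intro h I hI
    have := h I.toSubmodule ⟨(isIdeal_iff h0).mpr fun x hx y => lie_mem_left F P I x y hx, hI⟩
    exact LieSubmodule.toSubmodule_injective this
  · rintro h I ⟨hI, hle⟩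
    let I' : LieIdeal F P := { I with lie_mem := fun {x m} hm => lie_mem_comm.mp (hI m hm x).2 }
    exact congrArg LieSubmodule.toSubmodule (h I' hle)

theorem derivedSeq_eq (h0 : ∀ x y : P, x * y = 0) (n : ℕ) :
    derivedSeq F P n = (LieAlgebra.derivedSeries F P n).toSubmodule := by
  induction n with
  | zero => rfl
  | succ n ih =>
    rw [derivedSeq, LieAlgebra.derivedSeries_def, LieAlgebra.derivedSeriesOfIdeal_succ,
      LieSubmodule.lieIdeal_oper_eq_linear_span', ih]
    have : mulSpan F (LieAlgebra.derivedSeries F P n).toSubmodule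
        (LieAlgebra.derivedSeries F P n).toSubmodule = ⊥ :=
      eq_bot_iff.mpr (mulSpan_le.mpr fun x _ y _ => by simp [h0])
    rw [this, bot_sup_eq]
    rfl

theorem isSolvable_iff_lieAlgebra_isSolvable (h0 : ∀ x y : P, x * y = 0) :
    IsSolvable F P ↔ LieAlgebra.IsSolvable P := by
  rw [LieAlgebra.isSolvable_iff F P, IsSolvable]
  simp [derivedSeq_eq h0]

/-! ### Abelian nilradical, complements, and the derived algebra in characteristic zero -/

theorem isIdeal_lieSpan (h0 : ∀ x y : P, x * y = 0) {I : Submodule F P} (hI : IsIdeal F I) :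
    IsIdeal F (lieSpan F I I) := by
  refine (isIdeal_iff h0).mpr fun x hx y => lie_mem_comm.mp ?_
  refine lie_mem_of_mem_lieSpan hx fun p hp q hq => ?_
  rw [leibniz_lie]
  exact add_mem (lie_mem_lieSpan (lie_mem_comm.mp (hI p hp y).2) hq)
    (lie_mem_lieSpan hp (lie_mem_comm.mp (hI q hq y).2))

/-- The derived algebra of a Lie nilpotent ideal lies in the Frattini subalgebra. -/
theorem lieSpan_le_frattiniSubalgebra (h0 : ∀ x y : P, x * y = 0) {I : Submodule F P}
    (hI : IsIdeal F I) (hnil : ∃ m, liePow F I m = ⊥) :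
    lieSpan F I I ≤ frattiniSubalgebra F P := by
  refine le_sInf fun M hM => ?_
  by_contra hn
  have htop := hM.sup_eq_top (isIdeal_lieSpan h0 hI) hn
  obtain ⟨m, hm⟩ := hnil
  have hall : ∀ k, I ≤ M ⊔ liePow F I k := by
    intro k
    induction k with
    | zero => exact le_sup_right
    | succ k ih => exact ih.trans (sup_le le_sup_left (liePow_le_sup hM.1 hI htop k))
  have hIM : I ≤ M := by simpa [hm] using hall m
  exact hn (lieSpan_le.mpr fun x hx y hy => (hM.1 x (hIM hx) y (hIM hy)).2)

theorem IsPhiFree.lie_eq_zero (h : IsPhiFree F P) (h0 : ∀ x y : P, x * y = 0)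
    {I : Submodule F P} (hI : IsIdeal F I) (hnil : ∃ m, liePow F I m = ⊥) {x y : P}
    (hx : x ∈ I) (hy : y ∈ I) : ⁅x, y⁆ = 0 := by
  have := h.eq_bot (isIdeal_lieSpan h0 hI) (lieSpan_le_frattiniSubalgebra h0 hI hnil)
  exact (Submodule.mem_bot F).mp (this.le (lie_mem_lieSpan hx hy))

/-- The sum of two abelian ideals is Lie nilpotent. -/
theorem exists_liePow_sup_eq_bot {I J : Submodule F P} (hI : IsIdeal F I) (hJ : IsIdeal F J)
    (hIab : ∀ x ∈ I, ∀ y ∈ I, ⁅x, y⁆ = 0) (hJab : ∀ x ∈ J, ∀ y ∈ J, ⁅x, y⁆ = 0) :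
    ∃ m, liePow F (I ⊔ J) m = ⊥ := by
  -- Only mixed brackets survive, and these lie in both ideals; `I ⊓ J` commutes with `I` and with
  -- `J`.
  have h1 : liePow F (I ⊔ J) 1 ≤ I ⊓ J := by
    refine lieSpan_le.mpr fun x hx y hy => ?_
    obtain ⟨i, hi, j, hj, rfl⟩ := Submodule.mem_sup.mp hx
    obtain ⟨i', hi', j', hj', rfl⟩ := Submodule.mem_sup.mp hy
    rw [lie_add, add_lie, add_lie, hIab i hi i' hi', hJab j hj j' hj', zero_add, add_zero]
    exact ⟨add_mem (lie_mem_comm.mp (hI i' hi' j).2) (hI i hi j').2,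
      add_mem (hJ j hj i').2 (lie_mem_comm.mp (hJ j' hj' i).2)⟩
  refine ⟨2, eq_bot_iff.mpr (lieSpan_le.mpr fun x hx y hy => ?_)⟩
  obtain ⟨i, hi, j, hj, rfl⟩ := Submodule.mem_sup.mp hy
  rw [lie_add, hIab x (h1 hx).1 i hi, hJab x (h1 hx).2 j hj, add_zero]
  exact zero_mem _

theorem isIdeal_nilradical : IsIdeal F (nilradical F P) :=
  IsIdeal.sSup fun _ hI => hI.1

/-- The nilradical of a `φ`-free algebra with zero associative product is abelian. -/
theorem IsPhiFree.lie_eq_zero_of_mem_nilradical (h : IsPhiFree F P) (h0 : ∀ x y : P, x * y = 0)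
    {x y : P} (hx : x ∈ nilradical F P) (hy : y ∈ nilradical F P) : ⁅x, y⁆ = 0 := by
  rw [nilradical, sSup_eq_iSup'] at hx hy
  induction hx using Submodule.iSup_induction' with
  | mem I x hx =>
    induction hy using Submodule.iSup_induction' with
    | mem J y hy =>
      have hI := I.2
      have hJ := J.2
      -- `I` and `J` are each abelian, so `I ⊔ J` is Lie nilpotent, hence itself abelian.
      exact h.lie_eq_zero h0 (hI.1.sup hJ.1) (exists_liePow_sup_eq_bot hI.1 hJ.1
        (fun _ hu _ hv => h.lie_eq_zero h0 hI.1 hI.2.2 hu hv)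
        fun _ hu _ hv => h.lie_eq_zero h0 hJ.1 hJ.2.2 hu hv)
        (Submodule.mem_sup_left hx) (Submodule.mem_sup_right hy)
    | zero => exact lie_zero _
    | add a b _ _ ha hb => rw [lie_add, ha, hb, add_zero]
  | zero => exact zero_lie _
  | add a b _ _ ha hb => rw [add_lie, ha, hb, add_zero]

/-- An abelian ideal of a `φ`-free algebra with zero associative product is complemented by a
subalgebra. -/
theorem IsPhiFree.exists_isCompl [FiniteDimensional F P] (h : IsPhiFree F P)
    (h0 : ∀ x y : P, x * y = 0) {B : Submodule F P} (hB : IsIdeal F B)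
    (hab : ∀ x ∈ B, ∀ y ∈ B, ⁅x, y⁆ = 0) :
    ∃ U : Submodule F P, IsSubalgebra F U ∧ IsCompl B U := by
  -- A minimal subalgebra supplementing `B`; `⊤` is one, so a minimal one exists.
  obtain ⟨U, ⟨hU, hBU⟩, hmin⟩ := wellFounded_lt.has_min
    {U : Submodule F P | IsSubalgebra F U ∧ B ⊔ U = ⊤}
    ⟨⊤, fun _ _ _ _ => ⟨trivial, trivial⟩, sup_top_eq _⟩
  -- `B` centralizes `B ⊓ U` and `U` preserves it, and `P = B + U`.
  have hideal : IsIdeal F (B ⊓ U) := by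
    refine (isIdeal_iff h0).mpr fun x hx y => ⟨(hB x hx.1 y).2, ?_⟩
    obtain ⟨b, hb, u, hu, rfl⟩ := Submodule.mem_sup.mp (hBU.ge (trivial : y ∈ ⊤))
    rw [lie_add, hab x hx.1 b hb, zero_add]
    exact (hU x hx.2 u hu).2
  have hle : B ⊓ U ≤ frattiniSubalgebra F P := by
    refine le_sInf fun M hM => ?_
    by_contra hn
    have htop := hM.sup_eq_top hideal hn
    -- Modulo `B ⊓ U` every element of `U` lies in `M ⊓ U`, so minimality forces `U ≤ M`,
    -- contradicting `hn`.
    have hsup : B ⊔ (M ⊓ U) = ⊤ := by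
      refine eq_top_iff.mpr fun y _ => ?_
      obtain ⟨b, hb, u, hu, rfl⟩ := Submodule.mem_sup.mp (hBU.ge (trivial : y ∈ ⊤))
      obtain ⟨m, hm, c, hc, rfl⟩ := Submodule.mem_sup.mp (htop.ge (trivial : u ∈ ⊤))
      rw [add_comm m c, ← add_assoc]
      exact Submodule.add_mem_sup (add_mem hb hc.1)
        ⟨hm, (Submodule.add_mem_iff_left U hc.2).mp hu⟩
    have hlt := hmin (M ⊓ U) ⟨hM.1.inf hU, hsup⟩
    have hUM : M ⊓ U = U := eq_of_le_of_not_lt inf_le_right hlt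
    exact hn (inf_le_right.trans (inf_eq_right.mp hUM))
  exact ⟨U, hU, disjoint_iff.mpr (h.eq_bot hideal hle), codisjoint_iff.mpr hBU⟩

/-- In characteristic zero the derived algebra of a solvable algebra with zero associative product
lies in the nilradical. -/
theorem lieSpan_top_le_nilradical [CharZero F] [FiniteDimensional F P]
    (h0 : ∀ x y : P, x * y = 0) [LieAlgebra.IsSolvable P] :
    lieSpan F (⊤ : Submodule F P) ⊤ ≤ nilradical F P := by
  set D := LieAlgebra.derivedSeries F P 1 with hD
  have hmem : ∀ x y : P, ⁅x, y⁆ ∈ D := fun x y => by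
    rw [hD, LieAlgebra.derivedSeries_def, LieAlgebra.derivedSeriesOfIdeal_succ]
    exact LieSubmodule.lie_mem_lie (LieSubmodule.mem_top x) (LieSubmodule.mem_top y)
  have hDN : D.toSubmodule ≤ nilradical F P := by
    refine le_sSup ⟨(isIdeal_iff h0).mpr fun x _ y => hmem x y,
      ⟨1, eq_bot_iff.mpr (mulSpan_le.mpr fun x _ y _ => by simp [h0])⟩, ?_⟩
    -- `D` acts nilpotently on all of `P`, so the lower central series of the module `P` dominates
    -- the Lie powers of `D`.
    have : LieModule.IsNilpotent D P := LieModule.isNilpotent_derivedSeries_one P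
    obtain ⟨k, hk⟩ := LieModule.IsNilpotent.nilpotent F D P
    have hle : ∀ n, liePow F D.toSubmodule n ≤
        (LieModule.lowerCentralSeries F D P n).toSubmodule := by
      intro n
      induction n with
      | zero => exact le_top
      | succ n ih =>
        refine lieSpan_le.mpr fun x hx y hy => lie_mem_comm.mp ?_
        rw [LieModule.lowerCentralSeries_succ]
        exact LieSubmodule.lie_mem_lie (x := (⟨y, hy⟩ : D)) (LieSubmodule.mem_top _) (ih hx)
    exact ⟨k, eq_bot_iff.mpr ((hle k).trans (by rw [hk]; exact le_rfl))⟩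
  exact lieSpan_le.mpr fun x _ y _ => hDN (hmem x y)

end ZeroMul

end PoissonAlgebra

/-! ### Structure of solvable `φ`-free Poisson algebras -/

theorem mainTheorem10 (F : Type*) (P : Type*) [Field F] [PoissonRing P] [PoissonAlgebra F P]
    [FiniteDimensional F P] :
    (PoissonAlgebra.IsSolvable F P →
      (PoissonAlgebra.IsPhiFree F P ↔
        (∃ U : Submodule F P, PoissonAlgebra.IsSubalgebra F U ∧
          IsCompl (PoissonAlgebra.nilradical F P) U) ∧
        PoissonAlgebra.mulSpan F (⊤ : Submodule F P) ⊤ = ⊥ ∧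
        LieAlgebra.IsSolvable P ∧ PoissonAlgebra.IsPhiLFree F P) ∧
      (CharZero F → PoissonAlgebra.IsPhiFree F P →
        ∀ U : Submodule F P, PoissonAlgebra.IsSubalgebra F U →
          IsCompl (PoissonAlgebra.nilradical F P) U →
          PoissonAlgebra.mulSpan F U U ⊔ PoissonAlgebra.lieSpan F U U = ⊥)) ∧
    (PoissonAlgebra.mulSpan F (⊤ : Submodule F P) ⊤ = ⊥ →
      LieAlgebra.IsSolvable P → PoissonAlgebra.IsPhiLFree F P →
      PoissonAlgebra.IsSolvable F P ∧ PoissonAlgebra.IsPhiFree F P) := by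
  refine ⟨fun hs => ⟨⟨fun hphi => ?_, fun ⟨_, hmul, _, hL⟩ => ?_⟩, fun _ hphi U hU hc => ?_⟩,
    fun hmul hsol hL => ?_⟩
  · have hmul := hphi.mulSpan_top_eq_bot hs
    have h0 := PoissonAlgebra.mul_eq_zero_of_mulSpan_top hmul
    exact ⟨hphi.exists_isCompl h0 PoissonAlgebra.isIdeal_nilradical fun _ hx _ hy =>
        hphi.lie_eq_zero_of_mem_nilradical h0 hx hy, hmul,
      (PoissonAlgebra.isSolvable_iff_lieAlgebra_isSolvable h0).mp hs,
      (PoissonAlgebra.isPhiFree_iff_isPhiLFree h0).mp hphi⟩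
  · exact (PoissonAlgebra.isPhiFree_iff_isPhiLFree
      (PoissonAlgebra.mul_eq_zero_of_mulSpan_top hmul)).mpr hL
  · have h0 := PoissonAlgebra.mul_eq_zero_of_mulSpan_top (hphi.mulSpan_top_eq_bot hs)
    have := (PoissonAlgebra.isSolvable_iff_lieAlgebra_isSolvable h0).mp hs
    refine eq_bot_iff.mpr (sup_le (PoissonAlgebra.mulSpan_le.mpr fun x _ y _ => by simp [h0])
      (PoissonAlgebra.lieSpan_le.mpr fun x hx y hy => ?_))
    exact hc.disjoint.le_bot ⟨PoissonAlgebra.lieSpan_top_le_nilradical h0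
      (PoissonAlgebra.lie_mem_lieSpan trivial trivial), (hU x hx y hy).2⟩
  · have h0 := PoissonAlgebra.mul_eq_zero_of_mulSpan_top hmul
    exact ⟨(PoissonAlgebra.isSolvable_iff_lieAlgebra_isSolvable h0).mpr hsol,
      (PoissonAlgebra.isPhiFree_iff_isPhiLFree h0).mpr hL⟩
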